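/- **Conventions.** For functions $f,g:\omega_n\to\omega$, $f\le g$ means $f(\gamma)\le g(\gamma)$ for all $\gamma<\omega_n$, and $f\le^* g$ means $f(\gamma)\le g(\gamma)$ for all but finitely many $\gamma<\omega_n$. For a set $P$ with a quasi-order, $\mathrm{cf}(P)$ is the least cardinality of a cofinal subset of $P$. A *$\le^*$-ideal* is a nonempty, $\le^*$-downward closed, $\le^*$-directed subset of ${}^{\omega_n}\omega$. A *tree* is a partial order $(T,\le_T)$ in which the set of strict predecessors of each $t\in T$ is well-ordered; the order type of this set is the *height* $\mathrm{ht}_T(t)$, the $\alpha$-th level is the set of nodes of height $\alpha$, and the height of $T$ is the least $\alpha$ for which the $\alpha$-th level is empty. A *special $\omega_{n+1}$-Aronszajn tree* is a tree of height $\omega_{n+1}$ all of whose levels have cardinality at most $\aleph_n$ and for which there is a map $F:T\to\omega_n$ such that any two distinct nodes $s,t$ with $F(s)=F(t)$ are incomparable. Let $\Lambda_n$ be the class of ordinals of the form $\omega_n\cdot\beta$, and for a class $X$ of ordinals let $T\restriction X$ be the set of nodes of $T$ with height in $X$. Let $S^{n+1}_n$ be the set of ordinals $\alpha<\omega_{n+1}$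 with $\mathrm{cf}(\alpha)=\aleph_n$. For sets $Q\subseteq P\subseteq{}^{\omega_n}\omega$, $(P,Q)$ is a *strong $n$-unbounded pair* if: (a) $P$ is $\le^*$-directed; (b) no $p\in P$ satisfies $q\le^* p$ for all $q\in Q$; (c) there is a $\le^*$-cofinal subset $R$ of $Q$ with an enumeration $\langle r_\xi\mid\xi<\omega_n\rangle$ which is strictly increasing ($r_\xi\le^* r_\eta$ and $r_\eta\not\le^* r_\xi$ for $\xi<\eta$), and $\mathrm{cf}(P)=\mathrm{cf}(Q)=\mathrm{cf}(R)=\aleph_n$ with respect to $\le^*$; and (d) $Q$ is well-ordered by $\le$, and $f\le g\iff f\le^* g$ for all $f,g\in Q$. **Lemma.** Let $n>0$ be a natural number with $2^{\aleph_n}=\aleph_{n+1}$, and let $T$ be a special $\omega_{n+1}$-Aronszajn tree. Then there exist 1. a family $\langle P_\alpha\mid\alpha<\omega_{n+1}\rangle$ of $\le^*$-ideals of ${}^{\omega_n}\omega$ which is $\subseteq$-increasing, continuous ($P_\alpha=\bigcup_{\beta<\alpha}P_\beta$ for limit $\alpha<\omega_{n+1}$), has union ${}^{\omega_n}\omega$,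 and satisfies $\mathrm{cf}(P_\alpha,\le^*)\le\aleph_n$ for all $\alpha<\omega_{n+1}$, and 2. an order-preserving function $H:T\restriction\Lambda_n\to({}^{\omega_n}\omega,\le)$, such that for every $\alpha\in S^{n+1}_n$ there is a set $Q_\alpha\subseteq H[T\restriction(\Lambda_n\cap\omega_n\cdot\alpha)]$ for which 3. $(P_\alpha,Q_\alpha)$ is a strong $n$-unbounded pair, and 4. there is an $f_\alpha\in P_{\alpha+1}$ such that, for every $g\in Q_\alpha$, $g\le f_\alpha$ and $g(\gamma)<f_\alpha(\gamma)$ for infinitely many $\gamma<\omega_n$. -/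

import Mathlib

universe u

open Cardinal Ordinal Order Set

namespace TreeFiltration

/-! ### Trees -/

/-- A partial order is a (set-theoretic) tree if the strict predecessors of every element are
well-ordered. -/
class IsTree (T : Type u) [PartialOrder T] : Prop where
  isWellOrder_Iio : ∀ t : T, IsWellOrder (Set.Iio t) (· < ·)

/-- The height of a node of a tree: the order type of its set of strict predecessors. -/
noncomputable def nodeHeight {T : Type u} [PartialOrder T] [IsTree T] (t : T) : Ordinal.{u} :=
  haveI := IsTree.isWellOrder_Iio t
  Ordinal.type (fun a b : Set.Iio t => a < b)

/-- The `α`-th level of a tree. -/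
def level (T : Type u) [PartialOrder T] [IsTree T] (α : Ordinal.{u}) : Set T :=
  {t | nodeHeight t = α}

/-- A `κ⁺`-Aronszajn tree: the height of the tree, which is the least `α` whose level is empty,
is `κ⁺`, and all levels have cardinality at most `κ`. -/
structure IsAronszajn (κ : Cardinal.{u}) (T : Type u) [PartialOrder T] [IsTree T] : Prop where
  height_eq : IsLeast {α : Ordinal.{u} | level T α = ∅} (Order.succ κ).ord
  card_level_le : ∀ α : Ordinal.{u}, #(level T α) ≤ κ

/-- A special `κ⁺`-Aronszajn tree: there is a map into `κ` for which any two distinct nodes with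
the same value are incomparable. -/
structure IsSpecialAronszajn (κ : Cardinal.{u}) (T : Type u) [PartialOrder T] [IsTree T] : Prop
    extends IsAronszajn κ T where
  special : ∃ F : T → κ.ord.ToType, ∀ s t : T, F s = F t → s ≠ t → ¬ s ≤ t ∧ ¬ t ≤ s

/-- The class `Λ_n` of ordinal multiples `ω_n · β` of `ω_n`. -/
def multiplesOmega (n : ℕ) : Set Ordinal.{u} :=
  {α | ∃ β : Ordinal.{u}, α = ω_ (n : Ordinal.{u}) * β}

/-- The set of ordinals below `ω_m` of cofinality `ℵ_k`. -/
def cofSet (m k : ℕ) : Set Ordinal.{u} :=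
  {α | α < ω_ (m : Ordinal.{u}) ∧ α.cof = ℵ_ (k : Ordinal.{u})}

/-! ### Functions from `ω_n` to `ω` -/

/-- The set of functions from `ω_n` to `ω`; its default order is the coordinatewise one. -/
abbrev Fn (n : ℕ) : Type u := (ω_ (n : Ordinal.{u})).ToType → ℕ

/-- The quasi-order `≤*` on functions: `f ≤* g` if `f i ≤ g i` for all but finitely many `i`.
It is not an instance, so that `≤` on functions always denotes the coordinatewise order. -/
abbrev leStar (I : Type u) : Preorder (I → ℕ) where
  le f g := f ≤ᶠ[Filter.cofinite] g
  lt f g := f ≤ᶠ[Filter.cofinite] g ∧ ¬ g ≤ᶠ[Filter.cofinite] f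
  lt_iff_le_not_ge _ _ := Iff.rfl
  le_refl f := Filter.EventuallyLE.refl _ f
  le_trans _ _ _ h₁ h₂ := Filter.EventuallyLE.trans h₁ h₂

/-! ### Unbounded pairs in a quasi-order -/

/-- `R` is a `κ`-spine in `Q`: a cofinal subset of `Q` with a strictly increasing enumeration of
length `κ`. In a quasi-order, `x < y` means `x ≤ y` and not `y ≤ x`. -/
def IsSpine {X : Type u} [Preorder X] (κ : Cardinal.{u}) (Q R : Set X) : Prop :=
  R ⊆ Q ∧ IsCofinalFor Q R ∧ ∃ r : κ.ord.ToType → X, StrictMono r ∧ Set.range r = R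

/-- `(P, Q)` is a `κ`-unbounded pair. -/
structure IsUnboundedPair {X : Type u} [Preorder X] (κ : Cardinal.{u}) (P Q : Set X) : Prop where
  subset : Q ⊆ P
  directed : DirectedOn (· ≤ ·) P
  cof_left : Order.cof P = κ
  cof_right : Order.cof Q = κ
  unbounded : ¬ ∃ p ∈ P, ∀ q ∈ Q, q ≤ p
  spine : ∃ R : Set X, IsSpine κ Q R ∧ Order.cof R = κ

/-- A strong `κ`-unbounded pair of sets of functions: a `κ`-unbounded pair for `≤*` such that `Q`
is well-ordered and `≤` and `≤*` agree on `Q`. -/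
structure IsStrongUnboundedPair {I : Type u} (κ : Cardinal.{u}) (P Q : Set (I → ℕ)) : Prop where
  unboundedPair : @IsUnboundedPair (I → ℕ) (leStar I) κ P Q
  wellOrdered : IsWellOrder Q (· < ·)
  le_iff : ∀ f ∈ Q, ∀ g ∈ Q, f ≤ g ↔ (leStar I).le f g

/-! ### Filtrations -/

/-- `⟨P α ∣ α < δ⟩` is a continuous filtration of the whole type `X`. Only the values `P α` with
`α < δ` are relevant. -/
structure IsContinuousFiltration {X : Type u} (δ : Ordinal.{u}) (P : Ordinal.{u} → Set X) :
    Prop where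
  mono : ∀ α β, α ≤ β → β < δ → P α ⊆ P β
  continuous : ∀ α, α < δ → IsSuccLimit α → P α = ⋃ β ∈ Set.Iio α, P β
  union : ⋃ α ∈ Set.Iio δ, P α = Set.univ

/-- The cofinality of a set of functions with respect to `≤*`. -/
noncomputable def cofStar {I : Type u} (P : Set (I → ℕ)) : Cardinal.{u} :=
  @Order.cof P (@Subtype.preorder (I → ℕ) (leStar I) (· ∈ P))

/-- `P` is an order-ideal for `≤*`: nonempty, downward closed and directed. -/
def IsIdealStar {I : Type u} (P : Set (I → ℕ)) : Prop :=
  @Order.IsIdeal (I → ℕ) (leStar I).toLE P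

end TreeFiltration

/-! Write `δ` for `ω_n` and label the coordinates by `a : I → K` with all fibers infinite. The
specializing map `F` is injective below any node `t`, so at coordinate `i` the function `diagonal t`
can code the unique `s < t` with `F s = a i`, if there is one. For `s` of height `δ * β + ξ`, it
takes there the value of the `ξ`-th member of `finiteSups (G β)`, plus one; elsewhere it is zero. A
value depends only on the coded node, so the functions increase along branches, and passing from `s`
to `t > s` adds the infinite fiber of `F s` (`infinite_diagonal_lt`). A node of height at least `δ *
(β + 1)` has met every `ξ < δ`, so its function escapes the ideal of `G β`
(`not_diagonal_le_of_mem_idealStar`).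

Since `2 ^ ℵ_n = ℵ_(n+1)`, listing all functions as `x β` makes these ideals exhaust the space. If
`α` has cofinality `ℵ_n`, fix `t` on level `δ * α`: its predecessors on the levels `δ * β`, `β < α`,
give `Q`, and `t` itself gives the bound `f` in the next ideal. -/

namespace TreeFiltration

/-! ### Heights and chains in trees -/

section Trees

variable {T : Type u} [PartialOrder T] [IsTree T]

theorem exists_lt_nodeHeight_eq {t : T} {b : Ordinal.{u}} (h : b < nodeHeight t) :
    ∃ s < t, nodeHeight s = b := by
  have := IsTree.isWellOrder_Iio t
  obtain ⟨s, hs⟩ := typein_surj (fun a b : Set.Iio t => a < b) h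
  refine ⟨s.1, s.2, ?_⟩
  rw [← hs]
  have := IsTree.isWellOrder_Iio s.1
  unfold nodeHeight
  rw [← type_subrel]
  refine RelIso.ordinalType_congr ⟨⟨fun y => ⟨⟨y.1, lt_trans y.2 s.2⟩, y.2⟩,
    fun y => ⟨y.1.1, y.2⟩, fun _ => rfl, fun _ => rfl⟩, Iff.rfl⟩

theorem nodeHeight_strictMono : StrictMono (nodeHeight : T → Ordinal.{u}) := by
  intro s t hst
  have := IsTree.isWellOrder_Iio t
  have := IsTree.isWellOrder_Iio s
  refine lt_of_eq_of_lt ?_ (typein_lt_type (fun a b : Set.Iio t => a < b) ⟨s, hst⟩)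
  unfold nodeHeight
  rw [← type_subrel]
  refine RelIso.ordinalType_congr ⟨⟨fun y => ⟨⟨y.1, lt_trans y.2 hst⟩, y.2⟩,
    fun y => ⟨y.1.1, y.2⟩, fun _ => rfl, fun _ => rfl⟩, Iff.rfl⟩

theorem trichotomous_of_lt {r s t : T} (hr : r < t) (hs : s < t) : r < s ∨ r = s ∨ s < r := by
  have := IsTree.isWellOrder_Iio t
  rcases trichotomous_of (α := Set.Iio t) (· < ·) ⟨r, hr⟩ ⟨s, hs⟩ with h | h | h
  · exact Or.inl h
  · exact Or.inr (Or.inl (congrArg Subtype.val h))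
  · exact Or.inr (Or.inr h)

/-- Predecessors of `t` form a chain, and `F` is injective on chains. This is what makes `diagonal`
independent of choices. -/
theorem eq_of_lt_of_special {K : Type u} {F : T → K}
    (hF : ∀ s t : T, F s = F t → s ≠ t → ¬ s ≤ t ∧ ¬ t ≤ s) {r s t : T}
    (hr : r < t) (hs : s < t) (h : F r = F s) : r = s := by
  by_contra hne
  obtain ⟨h₁, h₂⟩ := hF r s h hne
  rcases trichotomous_of_lt hr hs with h' | h' | h'
  exacts [h₁ h'.le, hne h', h₂ h'.le]

/-- Any ordinal below the height of an Aronszajn tree is the height of a node. -/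
theorem IsAronszajn.exists_nodeHeight_eq {κ : Cardinal.{u}} (h : IsAronszajn κ T)
    {b : Ordinal.{u}} (hb : b < (Order.succ κ).ord) : ∃ t : T, nodeHeight t = b := by
  by_contra! hne
  exact hb.not_ge (h.height_eq.2 (Set.eq_empty_of_forall_notMem hne))

end Trees

/-! ### Ideals generated by finite suprema -/

section FiniteSups

variable {I : Type u}

/-- The set of suprema of finite subsets of `S`. -/
def finiteSups (S : Set (I → ℕ)) : Set (I → ℕ) :=
  {f | ∃ s : Finset (I → ℕ), (s : Set (I → ℕ)) ⊆ S ∧ s.sup id = f}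

theorem finiteSups_mono {S S' : Set (I → ℕ)} (h : S ⊆ S') : finiteSups S ⊆ finiteSups S' :=
  fun _ ⟨s, hs, hf⟩ => ⟨s, hs.trans h, hf⟩

theorem bot_mem_finiteSups (S : Set (I → ℕ)) : ⊥ ∈ finiteSups S :=
  ⟨∅, by simp, by simp⟩

theorem subset_finiteSups (S : Set (I → ℕ)) : S ⊆ finiteSups S :=
  fun f hf => ⟨{f}, by simpa using hf, by simp⟩

theorem sup_mem_finiteSups {S : Set (I → ℕ)} {f g : I → ℕ} (hf : f ∈ finiteSups S)
    (hg : g ∈ finiteSups S) : f ⊔ g ∈ finiteSups S := by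
  classical
  obtain ⟨s, hs, rfl⟩ := hf
  obtain ⟨t, ht, rfl⟩ := hg
  exact ⟨s ∪ t, by simpa using ⟨hs, ht⟩, Finset.sup_union⟩

theorem mk_finiteSups_le {κ : Cardinal.{u}} (hκ : ℵ₀ ≤ κ) {S : Set (I → ℕ)} (hS : #S ≤ κ) :
    #(finiteSups S) ≤ κ := by
  classical
  have hsub : finiteSups S ⊆ Set.range fun s : Finset S => s.sup (fun x => (x : I → ℕ)) := by
    rintro _ ⟨s, hs, rfl⟩
    refine ⟨s.subtype (· ∈ S), ?_⟩
    have h : (s.subtype (· ∈ S)).map (Function.Embedding.subtype _) = s := by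
      rw [Finset.subtype_map, Finset.filter_true_of_mem fun x hx => hs hx]
    conv_rhs => rw [← h, Finset.sup_map]
    rfl
  refine (mk_le_mk_of_subset hsub).trans (mk_range_le.trans ?_)
  cases finite_or_infinite S
  · exact (mk_le_aleph0 (α := Finset S)).trans hκ
  · rwa [mk_finset_of_infinite]

/-- The `≤*`-ideal generated by a set of functions. -/
def idealStar (S : Set (I → ℕ)) : Set (I → ℕ) :=
  {f | ∃ g ∈ finiteSups S, f ≤ᶠ[Filter.cofinite] g}

theorem idealStar_mono {S S' : Set (I → ℕ)} (h : S ⊆ S') : idealStar S ⊆ idealStar S' :=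
  fun _ ⟨g, hg, hf⟩ => ⟨g, finiteSups_mono h hg, hf⟩

theorem finiteSups_subset_idealStar (S : Set (I → ℕ)) : finiteSups S ⊆ idealStar S :=
  fun f hf => ⟨f, hf, Filter.EventuallyLE.refl _ f⟩

theorem subset_idealStar (S : Set (I → ℕ)) : S ⊆ idealStar S :=
  (subset_finiteSups S).trans (finiteSups_subset_idealStar S)

theorem isIdealStar_idealStar (S : Set (I → ℕ)) : IsIdealStar (idealStar S) := by
  refine @Order.IsIdeal.mk _ (leStar I).toLE _ ?_ ?_ ?_
  · rintro f g hgf ⟨h, hh, hfh⟩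
    exact ⟨h, hh, Filter.EventuallyLE.trans hgf hfh⟩
  · exact ⟨⊥, finiteSups_subset_idealStar S (bot_mem_finiteSups S)⟩
  · rintro f ⟨f', hf', hff'⟩ g ⟨g', hg', hgg'⟩
    refine ⟨f' ⊔ g', finiteSups_subset_idealStar S (sup_mem_finiteSups hf' hg'), ?_, ?_⟩
    · exact Filter.EventuallyLE.trans hff' (Filter.Eventually.of_forall fun i => le_sup_left)
    · exact Filter.EventuallyLE.trans hgg' (Filter.Eventually.of_forall fun i => le_sup_right)

theorem cofStar_idealStar_le {κ : Cardinal.{u}} (hκ : ℵ₀ ≤ κ) {S : Set (I → ℕ)} (hS : #S ≤ κ) :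
    cofStar (idealStar S) ≤ κ := by
  let inst : Preorder (idealStar S) := @Subtype.preorder (I → ℕ) (leStar I) (· ∈ idealStar S)
  have hcof : @IsCofinal (idealStar S) inst.toLE {f : idealStar S | f.1 ∈ finiteSups S} := by
    rintro ⟨f, g, hg, hfg⟩
    exact ⟨⟨g, finiteSups_subset_idealStar S hg⟩, hg, hfg⟩
  refine (@Order.cof_le (idealStar S) inst _ hcof).trans ?_
  refine le_trans ?_ (mk_finiteSups_le hκ hS)
  exact mk_le_of_injective (f := fun f => (⟨f.1.1, f.2⟩ : finiteSups S))
    fun f g h => Subtype.ext (Subtype.ext (congrArg (fun y : finiteSups S => y.1) h))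

/-- The ideal generated by a directed union is the union of the ideals. -/
theorem idealStar_eq_iUnion {α : Ordinal.{u}} (hα : α ≠ 0) {G : Ordinal.{u} → Set (I → ℕ)}
    (hmono : Monotone G) (hG : ∀ f ∈ G α, ∃ β < α, f ∈ G β) :
    idealStar (G α) = ⋃ β ∈ Set.Iio α, idealStar (G β) := by
  classical
  refine Set.Subset.antisymm ?_ (Set.iUnion₂_subset fun β hβ => idealStar_mono (hmono hβ.le))
  rintro f ⟨_, ⟨s, hs, rfl⟩, hf⟩
  suffices h : ∃ β < α, (s : Set (I → ℕ)) ⊆ G β by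
    obtain ⟨β, hβ, hsβ⟩ := h
    exact Set.mem_iUnion₂.2 ⟨β, hβ, _, ⟨s, hsβ, rfl⟩, hf⟩
  clear hf
  induction s using Finset.induction_on with
  | empty => exact ⟨0, pos_iff_ne_zero.2 hα, by simp⟩
  | insert g s _ ih =>
    rw [Finset.coe_insert, Set.insert_subset_iff] at hs
    obtain ⟨β, hβ, hsβ⟩ := ih hs.2
    obtain ⟨γ, hγ, hgγ⟩ := hG g hs.1
    refine ⟨max β γ, max_lt hβ hγ, ?_⟩
    rw [Finset.coe_insert, Set.insert_subset_iff]
    exact ⟨hmono (le_max_right _ _) hgγ, hsβ.trans (hmono (le_max_left _ _))⟩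

end FiniteSups

/-! ### Unbounded pairs from well-ordered chains -/

section Cofinality

variable {X A : Type u} [Preorder X] [LinearOrder A]

/-- A function reflecting and preserving `≤` as an order isomorphism onto its range. -/
noncomputable def orderIsoRange {q : A → X} (hq : ∀ a b, q a ≤ q b ↔ a ≤ b) :
    A ≃o Set.range q where
  toEquiv := Equiv.ofInjective q fun a b h =>
    le_antisymm ((hq a b).1 h.le) ((hq b a).1 h.ge)
  map_rel_iff' := hq _ _

theorem exists_isSpine_range [WellFoundedLT A] {q : A → X} (hq : ∀ a b, q a ≤ q b ↔ a ≤ b) :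
    ∃ R : Set X, IsSpine (Order.cof A) (Set.range q) R ∧ Order.cof R = Order.cof A := by
  obtain ⟨s, hs, hs'⟩ := exists_ord_cof_eq A
  have hiso : typeLT (Order.cof A).ord.ToType = typeLT s := by rw [hs', type_toType]
  obtain ⟨φ⟩ := type_eq.1 hiso
  let ψ : (Order.cof A).ord.ToType ≃o s := OrderIso.ofRelIsoLT φ
  have hr : ∀ i j, q (ψ i) ≤ q (ψ j) ↔ i ≤ j := fun i j => by
    rw [hq, Subtype.coe_le_coe, ψ.le_iff_le]
  refine ⟨Set.range fun i => q (ψ i), ⟨?_, ?_, fun i => q (ψ i), ?_, rfl⟩, ?_⟩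
  · rintro _ ⟨i, rfl⟩
    exact ⟨_, rfl⟩
  · rintro _ ⟨a, rfl⟩
    obtain ⟨b, hb, hab⟩ := hs a
    refine ⟨_, ⟨ψ.symm ⟨b, hb⟩, rfl⟩, ?_⟩
    rw [hq]
    simpa using hab
  · intro i j hij
    rw [lt_iff_le_not_ge, hr, hr]
    exact lt_iff_le_not_ge.1 hij
  · rw [← (orderIsoRange hr).cof_congr, cof_toType, Order.cof_ord_cof]

/-- An increasing union of sets `D a`, each of which fails to bound some value of `q`, forms an
unbounded pair with the range of `q`. -/
theorem isUnboundedPair_range [WellFoundedLT A] {P : Set X} {D : A → Set X} {q : A → X}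
    (hq : ∀ a b, q a ≤ q b ↔ a ≤ b) (hP : P = ⋃ a, D a) (hD : Monotone D)
    (hdir : DirectedOn (· ≤ ·) P) (hcof : Order.cof P ≤ Order.cof A) (hqP : ∀ a, q a ∈ P)
    (hunb : ∀ a, ∃ b, ∀ p ∈ D a, ¬ q b ≤ p) :
    IsUnboundedPair (Order.cof A) P (Set.range q) where
  subset := Set.range_subset_iff.2 hqP
  directed := hdir
  cof_left := by
    refine hcof.antisymm (Order.le_cof_iff.2 fun s hs => ?_)
    have hmem : ∀ p : s, ∃ a, (p.1 : X) ∈ D a := fun p => by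
      simpa [hP] using p.1.2
    -- The indices at which members of `s` appear are cofinal in `A`: were they all below some `a`,
    -- then `s` would lie in `D a` and bound no suitable `q b`.
    choose f hf using hmem
    refine (Order.cof_le (s := Set.range f) fun a => ?_).trans mk_range_le
    by_contra! hlt
    obtain ⟨b, hb⟩ := hunb a
    obtain ⟨p, hp, hbp⟩ := hs ⟨q b, hqP b⟩
    exact hb p (hD (hlt _ ⟨⟨p, hp⟩, rfl⟩).le (hf ⟨p, hp⟩)) hbp
  cof_right := (orderIsoRange hq).cof_congr.symm
  unbounded := by
    rintro ⟨p, hp, hle⟩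
    rw [hP] at hp
    obtain ⟨a, ha⟩ := Set.mem_iUnion.1 hp
    obtain ⟨b, hb⟩ := hunb a
    exact hb p ha (hle _ ⟨b, rfl⟩)
  spine := exists_isSpine_range hq

end Cofinality

/-! ### Enumerations and labellings -/

section Enumerations

theorem exists_ordinal_enumeration {X : Type u} [Inhabited X] {κ : Cardinal.{u}} {S : Set X}
    (hS : #S ≤ κ) : ∃ e : Ordinal.{u} → X, ∀ f ∈ S, ∃ ξ < κ.ord, e ξ = f := by
  have hS' : #S ≤ #κ.ord.ToType := by rwa [mk_ord_toType]
  obtain ⟨j⟩ := hS'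
  have hinj : Function.Injective fun f : S => typein (α := κ.ord.ToType) (· < ·) (j f) :=
    (typein_injective _).comp j.injective
  refine ⟨Function.extend (fun f : S => typein (α := κ.ord.ToType) (· < ·) (j f))
    Subtype.val default, fun f hf => ⟨_, typein_lt_self (j ⟨f, hf⟩), ?_⟩⟩
  exact hinj.extend_apply Subtype.val default ⟨f, hf⟩

/-- Infinite fibers let a single node of the tree refute `≤*`. -/
theorem exists_infinite_fibers {κ : Cardinal.{u}} (hκ : ℵ₀ ≤ κ) {I K : Type u} (hI : #I = κ)
    (hK : #K = κ) : ∃ a : I → K, ∀ k, {i | a i = k}.Infinite := by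
  have h : #I = #(K × ULift.{u} ℕ) := by
    rw [mk_prod, hI, hK]
    simp [mul_aleph0_eq hκ]
  obtain ⟨φ⟩ := Cardinal.eq.1 h
  refine ⟨fun i => (φ i).1, fun k => ?_⟩
  refine Set.infinite_of_injective_forall_mem (f := fun m : ℕ => φ.symm (k, ⟨m⟩)) ?_ ?_
  · intro m m' hm
    simpa using hm
  · intro m
    simp

end Enumerations

/-! ### The diagonal functions and the recursive generators -/

section Construction

variable {T : Type u} [PartialOrder T] [IsTree T] {I K : Type u}

open scoped Classical in
/-- The function attached to the node `t`: at a coordinate `i` whose label is that of some node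
`s < t` of height `δ * β + ξ` it exceeds the `ξ`-th function of the enumeration of `G β`. -/
noncomputable def diagonal (a : I → K) (F : T → K) (δ : Ordinal.{u})
    (e : Set (I → ℕ) → Ordinal.{u} → I → ℕ) (G : Ordinal.{u} → Set (I → ℕ)) (t : T) : I → ℕ :=
  fun i => if h : ∃ s < t, F s = a i then
    e (G (nodeHeight h.choose / δ)) (nodeHeight h.choose % δ) i + 1 else 0

theorem diagonal_apply {a : I → K} {F : T → K}
    (hF : ∀ s t : T, F s = F t → s ≠ t → ¬ s ≤ t ∧ ¬ t ≤ s) (δ : Ordinal.{u})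
    (e : Set (I → ℕ) → Ordinal.{u} → I → ℕ) (G : Ordinal.{u} → Set (I → ℕ)) {s t : T} {i : I}
    (hst : s < t) (hs : F s = a i) :
    diagonal a F δ e G t i = e (G (nodeHeight s / δ)) (nodeHeight s % δ) i + 1 := by
  have h : ∃ s < t, F s = a i := ⟨s, hst, hs⟩
  have heq : h.choose = s :=
    eq_of_lt_of_special hF h.choose_spec.1 hst (h.choose_spec.2.trans hs.symm)
  rw [diagonal, dif_pos h, heq]

theorem diagonal_eq_zero {a : I → K} {F : T → K} (δ : Ordinal.{u})
    (e : Set (I → ℕ) → Ordinal.{u} → I → ℕ) (G : Ordinal.{u} → Set (I → ℕ)) {t : T} {i : I}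
    (h : ∀ s < t, F s ≠ a i) : diagonal a F δ e G t i = 0 :=
  dif_neg fun ⟨s, hst, hs⟩ => h s hst hs

theorem diagonal_congr {a : I → K} {F : T → K} {δ : Ordinal.{u}}
    {e : Set (I → ℕ) → Ordinal.{u} → I → ℕ} {G G' : Ordinal.{u} → Set (I → ℕ)} {t : T}
    (h : ∀ s < t, G (nodeHeight s / δ) = G' (nodeHeight s / δ)) :
    diagonal a F δ e G t = diagonal a F δ e G' t := by
  funext i
  by_cases hi : ∃ s < t, F s = a i
  · rw [diagonal, diagonal, dif_pos hi, dif_pos hi, h _ hi.choose_spec.1]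
  · rw [diagonal, diagonal, dif_neg hi, dif_neg hi]

open scoped Classical in
/-- The generators of the `α`-th ideal: the first `α` functions of the enumeration `x`, and the
functions attached to nodes at the levels `δ * β` for `β < α`. -/
noncomputable def generators (x : Ordinal.{u} → I → ℕ) (a : I → K) (F : T → K) (δ : Ordinal.{u})
    (e : Set (I → ℕ) → Ordinal.{u} → I → ℕ) (α : Ordinal.{u}) : Set (I → ℕ) :=
  {f | ∃ β < α, f = x β ∨ ∃ t : T, nodeHeight t = δ * β ∧
    f = diagonal a F δ e (fun b => if _h : b < α then generators x a F δ e b else ∅) t}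
termination_by α

/-- Predecessors of a node on level `δ * β` have height with quotient by `δ` below `β`, so the
placeholder `∅` of the recursion is never consulted. -/
theorem mem_generators {x : Ordinal.{u} → I → ℕ} {a : I → K} {F : T → K} {δ : Ordinal.{u}}
    (hδ : δ ≠ 0) {e : Set (I → ℕ) → Ordinal.{u} → I → ℕ} {α : Ordinal.{u}} {f : I → ℕ} :
    f ∈ generators x a F δ e α ↔ ∃ β < α, f = x β ∨ ∃ t : T, nodeHeight t = δ * β ∧
      f = diagonal a F δ e (generators x a F δ e) t := by
  rw [generators, Set.mem_ofPred_eq]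
  refine exists_congr fun β => and_congr_right fun hβ => or_congr_right <| exists_congr fun t =>
    and_congr_right fun ht => ?_
  have hlt : ∀ s < t, nodeHeight s / δ < α := fun s hs =>
    lt_trans ((lt_mul_iff_div_lt hδ).1 (ht ▸ nodeHeight_strictMono hs)) hβ
  rw [diagonal_congr fun s hs => dif_pos (hlt s hs)]

theorem generators_mono {x : Ordinal.{u} → I → ℕ} {a : I → K} {F : T → K} {δ : Ordinal.{u}}
    (hδ : δ ≠ 0) {e : Set (I → ℕ) → Ordinal.{u} → I → ℕ} :
    Monotone (generators x a F δ e) := by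
  intro α α' h f hf
  rw [mem_generators hδ] at hf ⊢
  obtain ⟨β, hβ, hf⟩ := hf
  exact ⟨β, hβ.trans_le h, hf⟩

theorem mk_generators_le {x : Ordinal.{u} → I → ℕ} {a : I → K} {F : T → K} {δ : Ordinal.{u}}
    (hδ : δ ≠ 0) {e : Set (I → ℕ) → Ordinal.{u} → I → ℕ} {κ : Cardinal.{u}} (hκ : ℵ₀ ≤ κ)
    (hT : ∀ b : Ordinal.{u}, #(level T b) ≤ κ) {α : Ordinal.{u}} (hα : α.card ≤ κ) :
    #(generators x a F δ e α) ≤ κ := by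
  have hsub : generators x a F δ e α ⊆ ⋃ i : α.ToType,
      ({x i.toOrd} ∪ diagonal a F δ e (generators x a F δ e) '' level T (δ * i.toOrd)) := by
    intro f hf
    obtain ⟨β, hβ, hf⟩ := (mem_generators hδ).1 hf
    refine Set.mem_iUnion.2 ⟨ToType.mk ⟨β, hβ⟩, ?_⟩
    have hval : ((ToType.mk (⟨β, hβ⟩ : Set.Iio α)).toOrd : Ordinal) = β := by simp
    rw [hval]
    rcases hf with hf | ⟨t, ht, hf⟩
    · exact Or.inl hf
    · exact Or.inr ⟨t, ht, hf.symm⟩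
  refine (mk_le_mk_of_subset hsub).trans ((mk_iUnion_le _).trans ?_)
  refine (mul_le_mul' (by rwa [mk_toType]) (ciSup_le' fun i => ?_)).trans (mul_eq_self hκ).le
  refine (mk_union_le _ _).trans ((add_le_add ?_ (mk_image_le.trans (hT _))).trans
    (add_eq_self hκ).le)
  rw [mk_singleton]
  exact one_le_aleph0.trans hκ

theorem diagonal_mono {a : I → K} {F : T → K}
    (hF : ∀ s t : T, F s = F t → s ≠ t → ¬ s ≤ t ∧ ¬ t ≤ s) (δ : Ordinal.{u})
    (e : Set (I → ℕ) → Ordinal.{u} → I → ℕ) (G : Ordinal.{u} → Set (I → ℕ)) :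
    Monotone (diagonal a F δ e G) := by
  intro t t' htt' i
  by_cases h : ∃ s < t, F s = a i
  · obtain ⟨s, hst, hs⟩ := h
    rw [diagonal_apply hF δ e G hst hs, diagonal_apply hF δ e G (hst.trans_le htt') hs]
  · rw [diagonal_eq_zero δ e G fun s hst hs => h ⟨s, hst, hs⟩]
    exact Nat.zero_le _

theorem infinite_diagonal_lt {a : I → K} (ha : ∀ k, {i | a i = k}.Infinite) {F : T → K}
    (hF : ∀ s t : T, F s = F t → s ≠ t → ¬ s ≤ t ∧ ¬ t ≤ s) (δ : Ordinal.{u})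
    (e : Set (I → ℕ) → Ordinal.{u} → I → ℕ) (G : Ordinal.{u} → Set (I → ℕ)) {s t : T}
    (hst : s < t) : {i | diagonal a F δ e G s i < diagonal a F δ e G t i}.Infinite := by
  refine (ha (F s)).mono fun i hi => ?_
  -- On the fiber of `F s`, the larger function is a successor, while no `r < s` shares the label of
  -- `s`.
  rw [Set.mem_ofPred_eq, diagonal_apply hF δ e G hst (Eq.symm hi), diagonal_eq_zero]
  · exact Nat.succ_pos _
  · intro r hr h
    exact hr.ne (eq_of_lt_of_special hF (hr.trans hst) hst (h.trans hi))

theorem not_eventuallyLE_of_infinite {f g : I → ℕ} (h : {i | g i < f i}.Infinite) :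
    ¬ f ≤ᶠ[Filter.cofinite] g := by
  intro hle
  refine h ((Filter.eventually_cofinite.1 hle).subset fun i hi => ?_)
  exact not_le.2 hi

/-- The function attached to a node of height at least `δ * (β + 1)` is not bounded by any element
of the ideal generated by `G β`. -/
theorem not_diagonal_le_of_mem_idealStar {a : I → K} (ha : ∀ k, {i | a i = k}.Infinite)
    {F : T → K} (hF : ∀ s t : T, F s = F t → s ≠ t → ¬ s ≤ t ∧ ¬ t ≤ s) {δ : Ordinal.{u}}
    {e : Set (I → ℕ) → Ordinal.{u} → I → ℕ} {G : Ordinal.{u} → Set (I → ℕ)} {β : Ordinal.{u}}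
    (he : ∀ f ∈ finiteSups (G β), ∃ ξ < δ, e (G β) ξ = f) {t : T}
    (ht : δ * (β + 1) ≤ nodeHeight t) {p : I → ℕ} (hp : p ∈ idealStar (G β)) :
    ¬ diagonal a F δ e G t ≤ᶠ[Filter.cofinite] p := by
  obtain ⟨g, hg, hpg⟩ := hp
  obtain ⟨ξ, hξ, rfl⟩ := he g hg
  have hδ : δ ≠ 0 := (pos_of_gt hξ).ne'
  -- The predecessor of `t` at height `δ * β + ξ` codes exactly `e (G β) ξ`, by division with
  -- remainder.
  have hlt : δ * β + ξ < nodeHeight t := by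
    refine lt_of_lt_of_le ?_ ht
    rw [mul_add_one]
    exact add_lt_add_right hξ _
  obtain ⟨s, hst, hs⟩ := exists_lt_nodeHeight_eq hlt
  intro hle
  refine not_eventuallyLE_of_infinite ((ha (F s)).mono fun i hi => ?_) (hle.trans hpg)
  rw [Set.mem_ofPred_eq, diagonal_apply hF δ e G hst (Eq.symm hi), hs, mul_add_div _ hδ,
    div_eq_zero_of_lt hξ, add_zero, mul_add_mod_self, mod_eq_of_lt hξ]
  exact Nat.lt_succ_self _

end Construction

/-! ### The strong unbounded pair at a limit stage -/

/-- The chain of functions attached to the predecessors of a node at level `δ * α` forms a strong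
unbounded pair with the ideal generated by `G α`. -/
theorem exists_isStrongUnboundedPair {T : Type u} [PartialOrder T] [IsTree T] {I K : Type u}
    {a : I → K} (ha : ∀ k, {i | a i = k}.Infinite) {F : T → K}
    (hF : ∀ s t : T, F s = F t → s ≠ t → ¬ s ≤ t ∧ ¬ t ≤ s) {δ : Ordinal.{u}} (hδ : δ ≠ 0)
    {x : Ordinal.{u} → I → ℕ} {e : Set (I → ℕ) → Ordinal.{u} → I → ℕ} {α : Ordinal.{u}}
    (he : ∀ β < α, ∀ f ∈ finiteSups (generators x a F δ e β),
      ∃ ξ < δ, e (generators x a F δ e β) ξ = f)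
    (hα : IsSuccLimit α) {t : T} (ht : nodeHeight t = δ * α)
    (hcof : cofStar (idealStar (generators x a F δ e α)) ≤ α.cof) :
    ∃ Q ⊆ diagonal a F δ e (generators x a F δ e) ''
        {s | s < t ∧ ∃ β < α, nodeHeight s = δ * β},
      IsStrongUnboundedPair α.cof (idealStar (generators x a F δ e α)) Q := by
  set G := generators x a F δ e with hG
  set H := diagonal a F δ e G with hH
  have hGmono : Monotone G := generators_mono hδ
  have hnode : ∀ i : α.ToType, ∃ s < t, nodeHeight s = δ * i.toOrd := fun i => by
    refine exists_lt_nodeHeight_eq ?_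
    rw [ht]
    exact mul_lt_mul_of_pos_left i.toOrd.2 (pos_iff_ne_zero.2 hδ)
  choose s hst hs using hnode
  have hslt : ∀ i j, i < j → s i < s j := fun i j hij => by
    have hlt : nodeHeight (s i) < nodeHeight (s j) := by
      rw [hs, hs]
      refine mul_lt_mul_of_pos_left ?_ (pos_iff_ne_zero.2 hδ)
      exact ToType.mk.symm.strictMono hij
    rcases trichotomous_of_lt (hst i) (hst j) with h | h | h
    · exact h
    · exact absurd (congrArg nodeHeight h) hlt.ne
    · exact absurd (nodeHeight_strictMono h) hlt.not_gt
  have hHmono : Monotone H := diagonal_mono hF δ e G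
  have hsmono : Monotone s := (show StrictMono s from fun i j => hslt i j).monotone
  have hnle : ∀ i j, i < j → ¬ H (s j) ≤ᶠ[Filter.cofinite] H (s i) := fun i j hij =>
    not_eventuallyLE_of_infinite (infinite_diagonal_lt ha hF δ e G (hslt i j hij))
  have hle : ∀ i j, H (s i) ≤ H (s j) ↔ i ≤ j := fun i j =>
    ⟨fun h => not_lt.1 fun hij => hnle j i hij (Filter.Eventually.of_forall h),
      fun h => hHmono (hsmono h)⟩
  have hleStar : ∀ i j, (leStar I).le (H (s i)) (H (s j)) ↔ i ≤ j := fun i j =>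
    ⟨fun h => not_lt.1 fun hij => hnle j i hij h,
      fun h => Filter.Eventually.of_forall (hHmono (hsmono h))⟩
  have hunion : idealStar (G α) = ⋃ i : α.ToType, idealStar (G i.toOrd) := by
    rw [idealStar_eq_iUnion hα.ne_bot hGmono fun f hf => ?_]
    · ext f
      simp only [Set.mem_iUnion, Set.mem_Iio, exists_prop]
      constructor
      · rintro ⟨β, hβ, hf⟩
        exact ⟨ToType.mk ⟨β, hβ⟩, by simpa using hf⟩
      · rintro ⟨i, hf⟩
        exact ⟨i.toOrd, i.toOrd.2, hf⟩
    · obtain ⟨β, hβ, hf⟩ := (mem_generators hδ).1 hf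
      exact ⟨β + 1, hα.add_one_lt hβ, (mem_generators hδ).2 ⟨β, lt_add_one β, hf⟩⟩
  refine ⟨Set.range fun i => H (s i), ?_, ?_, ?_, ?_⟩
  · rintro _ ⟨i, rfl⟩
    exact ⟨s i, ⟨hst i, i.toOrd, i.toOrd.2, hs i⟩, rfl⟩
  · rw [← cof_toType] at hcof ⊢
    refine @isUnboundedPair_range (I → ℕ) α.ToType (leStar I) _ _ _
      (fun i => idealStar (G i.toOrd)) _ hleStar hunion ?_ ?_ hcof ?_ ?_
    · intro i j hij
      exact idealStar_mono (hGmono (ToType.mk.symm.monotone hij))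
    · exact @Order.IsIdeal.Directed _ (leStar I).toLE _ (isIdealStar_idealStar (G α))
    · intro i
      exact subset_idealStar _ ((mem_generators hδ).2 ⟨i.toOrd, i.toOrd.2, Or.inr ⟨s i, hs i, rfl⟩⟩)
    · intro i
      -- The next node of the chain, at height `δ * (i + 1)`, already lies above a full block of
      -- length `δ` coding the `i`-th ideal.
      refine ⟨ToType.mk ⟨i.toOrd + 1, hα.add_one_lt i.toOrd.2⟩, fun p hp => ?_⟩
      refine not_diagonal_le_of_mem_idealStar ha hF (he _ i.toOrd.2) ?_ hp
      rw [hs]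
      simp
  · exact (orderIsoRange hle).symm.toRelIsoLT.toRelEmbedding.isWellOrder
  · rintro _ ⟨i, rfl⟩ _ ⟨j, rfl⟩
    rw [hle, hleStar]

end TreeFiltration

/-! ### The main theorem -/

open TreeFiltration

theorem mainTheorem6 (n : ℕ) (hn : 0 < n)
    (hpow : (2 : Cardinal.{u}) ^ (ℵ_ (n : Ordinal.{u})) = ℵ_ ((n + 1 : ℕ) : Ordinal.{u}))
    (T : Type u) [PartialOrder T] [TreeFiltration.IsTree T]
    (hT : TreeFiltration.IsSpecialAronszajn (ℵ_ (n : Ordinal.{u})) T) :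
    ∃ (P : Ordinal.{u} → Set (TreeFiltration.Fn.{u} n))
      (H : {t : T // TreeFiltration.nodeHeight t ∈ TreeFiltration.multiplesOmega n} →
        TreeFiltration.Fn.{u} n),
      TreeFiltration.IsContinuousFiltration (ω_ ((n + 1 : ℕ) : Ordinal.{u})) P ∧
      (∀ α < ω_ ((n + 1 : ℕ) : Ordinal.{u}),
        TreeFiltration.IsIdealStar (P α) ∧
        TreeFiltration.cofStar (P α) ≤ ℵ_ (n : Ordinal.{u})) ∧
      Monotone H ∧
      ∀ α ∈ TreeFiltration.cofSet.{u} (n + 1) n,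
        ∃ Q ⊆ H '' {x | TreeFiltration.nodeHeight x.1 < ω_ (n : Ordinal.{u}) * α},
          TreeFiltration.IsStrongUnboundedPair (ℵ_ (n : Ordinal.{u})) (P α) Q ∧
          ∃ f ∈ P (α + 1), ∀ g ∈ Q, g ≤ f ∧ {i | g i < f i}.Infinite := by
  have hκ : ℵ₀ ≤ ℵ_ (n : Ordinal.{u}) := aleph0_le_aleph _
  have hδ : ω_ (n : Ordinal.{u}) ≠ 0 := (omega_pos _).ne'
  have hsucc : ℵ_ ((n + 1 : ℕ) : Ordinal.{u}) = Order.succ (ℵ_ (n : Ordinal.{u})) := by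
    rw [Nat.cast_add_one, succ_aleph]
  have hcard : ∀ α < ω_ ((n + 1 : ℕ) : Ordinal.{u}), α.card ≤ ℵ_ (n : Ordinal.{u}) := by
    intro α hα
    rwa [lt_omega_iff_card_lt, hsucc, Order.lt_succ_iff] at hα
  have hI : #(ω_ (n : Ordinal.{u})).ToType = ℵ_ (n : Ordinal.{u}) := by
    rw [mk_toType, card_omega]
  obtain ⟨F, hF⟩ := hT.special
  obtain ⟨a, ha⟩ := exists_infinite_fibers hκ hI (mk_ord_toType (ℵ_ (n : Ordinal.{u})))
  have hFn : #(Set.univ : Set (Fn.{u} n)) ≤ ℵ_ ((n + 1 : ℕ) : Ordinal.{u}) := by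
    rw [mk_univ, ← hpow]
    simp [hI, power_eq_two_power hκ]
  obtain ⟨x, hx⟩ := exists_ordinal_enumeration hFn
  rw [ord_aleph] at hx
  -- Enumerations are fixed for every set `S` in advance, because `G` is defined by recursion from
  -- `e`.
  have hex : ∀ S : Set (Fn.{u} n), ∃ e : Ordinal.{u} → Fn.{u} n, #S ≤ ℵ_ (n : Ordinal.{u}) →
      ∀ f ∈ finiteSups S, ∃ ξ < ω_ (n : Ordinal.{u}), e ξ = f := by
    intro S
    by_cases hS : #S ≤ ℵ_ (n : Ordinal.{u})
    · obtain ⟨e, he⟩ := exists_ordinal_enumeration (mk_finiteSups_le hκ hS)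
      rw [ord_aleph] at he
      exact ⟨e, fun _ => he⟩
    · exact ⟨default, fun h => absurd h hS⟩
  choose e he using hex
  set G := generators x a F (ω_ (n : Ordinal.{u})) e with hG
  have hGmono : Monotone G := generators_mono hδ
  have hGcard : ∀ α < ω_ ((n + 1 : ℕ) : Ordinal.{u}), #(G α) ≤ ℵ_ (n : Ordinal.{u}) :=
    fun α hα => mk_generators_le hδ hκ hT.card_level_le (hcard α hα)
  refine ⟨fun α => idealStar (G α), fun t => diagonal a F (ω_ (n : Ordinal.{u})) e G t.1,
    ⟨fun α β h _ => idealStar_mono (hGmono h), fun α _ hα => ?_, ?_⟩,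
    fun α hα => ⟨isIdealStar_idealStar _, cofStar_idealStar_le hκ (hGcard α hα)⟩,
    fun s t hst => diagonal_mono hF _ e G hst, ?_⟩
  · refine idealStar_eq_iUnion hα.ne_bot hGmono fun f hf => ?_
    obtain ⟨β, hβ, hf⟩ := (mem_generators hδ).1 hf
    exact ⟨β + 1, hα.add_one_lt hβ, (mem_generators hδ).2 ⟨β, lt_add_one β, hf⟩⟩
  · refine Set.eq_univ_of_forall fun f => ?_
    obtain ⟨β, hβ, rfl⟩ := hx f trivial
    refine Set.mem_iUnion₂.2 ⟨β + 1, (isSuccLimit_omega _).add_one_lt hβ, subset_idealStar _ ?_⟩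
    exact (mem_generators hδ).2 ⟨β, lt_add_one β, Or.inl rfl⟩
  · rintro α ⟨hα, hαcof⟩
    have hlim : IsSuccLimit α := by
      rw [← one_lt_cof_iff, hαcof]
      exact one_lt_aleph0.trans_le hκ
    -- Level `ω_n * α` is below the height of `T`, hence nonempty.
    have hmul : ω_ (n : Ordinal.{u}) * α < (Order.succ (ℵ_ (n : Ordinal.{u}))).ord := by
      rw [lt_ord, Order.lt_succ_iff, card_mul, card_omega]
      exact (mul_le_mul' le_rfl (hcard α hα)).trans (mul_eq_self hκ).le
    obtain ⟨t, ht⟩ := hT.exists_nodeHeight_eq hmul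
    obtain ⟨Q, hQ, hpair⟩ := exists_isStrongUnboundedPair ha hF hδ (α := α)
      (fun β hβ => he (G β) (hGcard β (hβ.trans hα))) hlim ht
      (by rw [hαcof]; exact cofStar_idealStar_le hκ (hGcard α hα))
    rw [hαcof] at hpair
    refine ⟨Q, fun f hf => ?_, hpair, diagonal a F (ω_ (n : Ordinal.{u})) e G t,
      subset_idealStar _ ((mem_generators hδ).2 ⟨α, lt_add_one α, Or.inr ⟨t, ht, rfl⟩⟩), ?_⟩
    · obtain ⟨s, ⟨hst, β, hβ, hs⟩, rfl⟩ := hQ hf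
      exact ⟨⟨s, β, hs⟩, by simpa [ht] using nodeHeight_strictMono hst, rfl⟩
    · intro g hg
      obtain ⟨s, ⟨hst, -⟩, rfl⟩ := hQ hg
      exact ⟨diagonal_mono hF _ e G hst.le, infinite_diagonal_lt ha hF _ e G hst⟩
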